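/- Let $L^2=L^2(\mathbb T)$ and $L^\infty=L^\infty(\mathbb T)$ with respect to normalized Lebesgue measure on the unit circle $\mathbb T$, let $H^2\subset L^2$ be the Hardy space of all $f\in L^2$ whose Fourier coefficients of negative index vanish, and let $P$ be the orthogonal projection of $L^2$ onto $H^2$. A bounded operator on $H^2$ is a Toeplitz operator if it is of the form $T_\varphi f=P(\varphi f)$ for some $\varphi\in L^\infty$. For a tuple $\boldsymbol A=(A_1,\dots,A_d)$ of bounded operators on $H^2$ regard $\boldsymbol A$ as the operator $x\mapsto(A_1x,\dots,A_dx)$ from $H^2$ to the Hilbert direct sum of $d$ copies of $H^2$, with its operator norm, and put $$\operatorname{dist}(\boldsymbol A,\mathbb C^d\boldsymbol I)=\min_{z\in\mathbb C^d}\|(A_1-z_1I,\dots,A_d-z_dI)\|,\qquad \operatorname{var}_x(\boldsymbol A)=\|\boldsymbol Ax\|^2-\sum_{j=1}^d|\langle x, A_jx\rangle|^2 .$$ Then for every $d$ and every tuple $\boldsymbol A=(A_1,\dots,A_d)$ of Toeplitz operators on $H^2$, the minimum defining $\operatorname{dist}(\boldsymbol A,\mathbb C^d\boldsymbol I)$ is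 attained and $$\operatorname{dist}(\boldsymbol A,\mathbb C^d\boldsymbol I)^2=\sup_{\|x\|=1}\operatorname{var}_x(\boldsymbol A).$$ Such tuples need not commute: for every $d\ge 2$ there is a tuple $(A_1,\dots,A_d)$ of Toeplitz operators on $H^2$ with $A_iA_j\ne A_jA_i$ for some $i,j$. -/

import Mathlib

open MeasureTheory
open scoped ENNReal

noncomputable section

/-! ### Tuples of operators on a Hilbert space -/

section Tuples

variable {H : Type*} [NormedAddCommGroup H] [InnerProductSpace ℂ H] {d : ℕ}

/-- The tuple `(A₁, …, A_d)` as the bounded operator `x ↦ (A₁ x, …, A_d x)` from `H` to the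
Hilbert direct sum of `d` copies of `H`. Its norm is the operator norm. -/
def tupleOp (A : Fin d → H →L[ℂ] H) : H →L[ℂ] PiLp 2 (fun _ : Fin d => H) :=
  (PiLp.continuousLinearEquiv 2 ℂ (fun _ : Fin d => H)).symm.toContinuousLinearMap ∘L
    ContinuousLinearMap.pi A

/-- The tuple `z I = (z₁ I, …, z_d I)` of scalar operators. -/
def scalarTuple (H : Type*) [NormedAddCommGroup H] [InnerProductSpace ℂ H] {d : ℕ}
    (z : Fin d → ℂ) : Fin d → H →L[ℂ] H :=
  fun j => z j • ContinuousLinearMap.id ℂ H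

/-- `dist(A, ℂ^d I)`, the distance from the tuple `A` to the scalar tuples. -/
def distScalars (A : Fin d → H →L[ℂ] H) : ℝ :=
  ⨅ z : Fin d → ℂ, ‖tupleOp (A - scalarTuple H z)‖

/-- The variance `var_x(A) = ‖A x‖² - ∑ⱼ |⟨x, Aⱼ x⟩|²`. -/
def tupleVar (A : Fin d → H →L[ℂ] H) (x : H) : ℝ :=
  ‖tupleOp A x‖ ^ 2 - ∑ j, ‖inner ℂ x (A j x)‖ ^ 2

end Tuples

/-! ### The Hardy space of the circle and Toeplitz operators -/

/-- Normalized Lebesgue measure on the circle, parametrized by `t ∈ ℝ / ℤ` through `t ↦ exp(2πit)`. -/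
abbrev circleMeasure : Measure UnitAddCircle := AddCircle.haarAddCircle

/-- The space `L²` of the circle. -/
abbrev CircleL2 : Type := Lp ℂ 2 circleMeasure

/-- The space `L^∞` of the circle. -/
abbrev CircleLinfty : Type := Lp ℂ ∞ circleMeasure

/-- The Hardy space `H²`: the functions in `L²` of the circle all of whose Fourier coefficients
of negative index vanish. -/
def hardySpace : Submodule ℂ CircleL2 where
  carrier := {f | ∀ n : ℤ, n < 0 → fourierCoeff f n = 0}
  zero_mem' := fun n _ => by
    rw [← fourierBasis_repr]; simp
  add_mem' := fun {f g} hf hg n hn => by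
    have h1 := hf n hn
    have h2 := hg n hn
    rw [← fourierBasis_repr] at h1 h2 ⊢
    simp [h1, h2]
  smul_mem' := fun c f hf n hn => by
    have h1 := hf n hn
    rw [← fourierBasis_repr] at h1 ⊢
    simp [h1]

theorem isClosed_hardySpace : IsClosed (hardySpace : Set CircleL2) := by
  have h : (hardySpace : Set CircleL2) =
      ⋂ (n : ℤ) (_ : n < 0), {f : CircleL2 | inner ℂ (fourierBasis n : CircleL2) f = 0} := by
    ext f
    simp only [Set.mem_iInter, Set.mem_ofPred_eq]
    refine forall_congr' fun n => forall_congr' fun _ => ?_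
    rw [← fourierBasis_repr, HilbertBasis.repr_apply_apply]
  rw [h]
  exact isClosed_iInter fun n => isClosed_iInter fun _ =>
    isClosed_eq (continuous_const.inner continuous_id) continuous_const

instance instCompleteSpaceHardySpace : CompleteSpace hardySpace :=
  isClosed_hardySpace.completeSpace_coe

/-- Multiplication by `φ ∈ L^∞` as a bounded operator on `L²` of the circle. -/
def mulOp (φ : CircleLinfty) : CircleL2 →L[ℂ] CircleL2 :=
  (ContinuousLinearMap.mul ℂ ℂ).holderL circleMeasure ∞ 2 2 φ

/-- The Toeplitz operator `T_φ f = P (φ f)` on the Hardy space, where `P` is the orthogonal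
projection of `L²` onto `H²`. -/
def toeplitz (φ : CircleLinfty) : hardySpace →L[ℂ] hardySpace :=
  hardySpace.orthogonalProjectionOnto ∘L mulOp φ ∘L hardySpace.subtypeL

/-- An operator on the Hardy space is a Toeplitz operator if it is `T_φ` for some `φ ∈ L^∞`. -/
def IsToeplitz (A : hardySpace →L[ℂ] hardySpace) : Prop :=
  ∃ φ : CircleLinfty, A = toeplitz φ

end

/-! ### The variance formula for tuples with a weakly null dilation. -/

section Tuples

open Filter Topology

variable {H : Type*} [NormedAddCommGroup H] [InnerProductSpace ℂ H] {d : ℕ}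

/-! At a unit vector, `var_x(A)` is the minimum over `z` of `‖(A - z) x‖²`, so it never exceeds
`dist²`. For the converse, let `V` be the supremum of the variances and `S` the shift. Since `S*ⁿ
A_j Sⁿ = A_j` and `Sⁿ → 0` weakly, `√(1-t) x + √t Sⁿ y` acts for large `n` like an orthogonal sum:
the means `⟨u, A_j u⟩` combine convexly and `‖A_j u‖²` at least so. Hence (`tupleVar_add_le`), with
`c` the means at `x`, `(1-t) var_x + t ‖(A - c) y‖² - O(t²) ≤ V`. Let `x` run through a maximizing
sequence with means tending to `m`, divide by `t` and let `t → 0`: `‖(A - m) y‖² ≤ V` for every unit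
`y`. So `m` attains the distance, and `dist² = V`. -/

theorem norm_tupleOp_apply_sq (A : Fin d → H →L[ℂ] H) (x : H) :
    ‖tupleOp A x‖ ^ 2 = ∑ j, ‖A j x‖ ^ 2 := by
  rw [PiLp.norm_sq_eq_of_L2]
  rfl

theorem norm_sub_smul_sq {x : H} (hx : ‖x‖ = 1) (y : H) (w : ℂ) :
    ‖y - w • x‖ ^ 2 = ‖y‖ ^ 2 - 2 * (starRingEnd ℂ w * inner ℂ x y).re + ‖w‖ ^ 2 := by
  rw [@norm_sub_sq ℂ, inner_smul_right, norm_smul, hx, mul_one, ← inner_conj_symm y x]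
  have : w * starRingEnd ℂ (inner ℂ x y) = starRingEnd ℂ (starRingEnd ℂ w * inner ℂ x y) := by
    simp
  rw [this, RCLike.conj_re]
  rfl

theorem norm_tupleOp_sub_scalarTuple_apply_sq (A : Fin d → H →L[ℂ] H) (z : Fin d → ℂ)
    {x : H} (hx : ‖x‖ = 1) :
    ‖tupleOp (A - scalarTuple H z) x‖ ^ 2 =
      ∑ j, (‖A j x‖ ^ 2 - 2 * (starRingEnd ℂ (z j) * inner ℂ x (A j x)).re + ‖z j‖ ^ 2) := by
  rw [norm_tupleOp_apply_sq]
  refine Finset.sum_congr rfl fun j _ => ?_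
  rw [← norm_sub_smul_sq hx]
  rfl

theorem tupleVar_eq_sum (A : Fin d → H →L[ℂ] H) (x : H) :
    tupleVar A x = ∑ j, (‖A j x‖ ^ 2 - ‖inner ℂ x (A j x)‖ ^ 2) := by
  rw [tupleVar, norm_tupleOp_apply_sq, Finset.sum_sub_distrib]

theorem complex_norm_sub_sq (a b : ℂ) :
    ‖a - b‖ ^ 2 = ‖a‖ ^ 2 - 2 * (starRingEnd ℂ b * a).re + ‖b‖ ^ 2 := by
  simp only [← Complex.normSq_eq_norm_sq, Complex.normSq_apply, Complex.sub_re, Complex.sub_im,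
    Complex.mul_re, Complex.conj_re, Complex.conj_im]
  ring

/-- The gap at `x` is `∑ j, |⟨x, A_j x⟩ - z_j|²`. -/
theorem tupleVar_le_norm_sq (A : Fin d → H →L[ℂ] H) (z : Fin d → ℂ) {x : H} (hx : ‖x‖ = 1) :
    tupleVar A x ≤ ‖tupleOp (A - scalarTuple H z)‖ ^ 2 := by
  have h1 : tupleVar A x ≤ ‖tupleOp (A - scalarTuple H z) x‖ ^ 2 := by
    rw [norm_tupleOp_sub_scalarTuple_apply_sq A z hx, tupleVar_eq_sum]
    refine Finset.sum_le_sum fun j _ => ?_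
    have := complex_norm_sub_sq (inner ℂ x (A j x)) (z j)
    nlinarith [sq_nonneg ‖inner ℂ x (A j x) - z j‖]
  refine h1.trans ?_
  gcongr
  simpa [hx] using (tupleOp (A - scalarTuple H z)).le_opNorm x

theorem tupleVar_le_distScalars_sq (A : Fin d → H →L[ℂ] H) {x : H} (hx : ‖x‖ = 1) :
    tupleVar A x ≤ distScalars A ^ 2 := by
  have h0 : 0 ≤ distScalars A := Real.iInf_nonneg fun _ => ContinuousLinearMap.opNorm_nonneg _
  rw [← Real.sqrt_le_left h0]
  refine le_ciInf fun z => ?_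
  rw [Real.sqrt_le_left (ContinuousLinearMap.opNorm_nonneg _)]
  exact tupleVar_le_norm_sq A z hx

theorem distScalars_le (A : Fin d → H →L[ℂ] H) (z : Fin d → ℂ) :
    distScalars A ≤ ‖tupleOp (A - scalarTuple H z)‖ :=
  ciInf_le ⟨0, by rintro _ ⟨z, rfl⟩; exact ContinuousLinearMap.opNorm_nonneg _⟩ z

/-- Homogeneous form of a bound for the variance at unit vectors. -/
theorem norm_sq_mul_sub_le_of_tupleVar_le {A : Fin d → H →L[ℂ] H} {V : ℝ}
    (hV : ∀ x : H, ‖x‖ = 1 → tupleVar A x ≤ V) (u : H) :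
    ∑ j, (‖A j u‖ ^ 2 * ‖u‖ ^ 2 - ‖inner ℂ u (A j u)‖ ^ 2) ≤ V * (‖u‖ ^ 2) ^ 2 := by
  rcases eq_or_ne u 0 with rfl | hu
  · simp
  have hn : ‖u‖ ≠ 0 := norm_ne_zero_iff.2 hu
  set c : ℂ := ((‖u‖⁻¹ : ℝ) : ℂ) with hc
  have hcn : ‖c‖ = ‖u‖⁻¹ := by simp [hc]
  have h := hV (c • u) (by rw [norm_smul, hcn, inv_mul_cancel₀ hn])
  rw [tupleVar_eq_sum] at h
  have h2 : ∑ j, (‖A j u‖ ^ 2 * ‖u‖ ^ 2 - ‖inner ℂ u (A j u)‖ ^ 2) =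
      (‖u‖ ^ 2) ^ 2 *
        ∑ j, (‖A j (c • u)‖ ^ 2 - ‖inner ℂ (c • u) (A j (c • u))‖ ^ 2) := by
    rw [Finset.mul_sum]
    refine Finset.sum_congr rfl fun j _ => ?_
    rw [map_smul, inner_smul_left, inner_smul_right, norm_smul, norm_mul, norm_mul,
      RCLike.norm_conj, hcn]
    field_simp
  rw [h2, mul_comm V]
  exact mul_le_mul_of_nonneg_left h (by positivity)

/-- A sequence of isometric self-maps of a Hilbert space that tends weakly to zero and
compresses each entry of the tuple `A` to itself. For the unilateral shift, this is the
Brown–Halmos characterization of Toeplitz operators. -/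
structure IsWeaklyNullDilation (A : Fin d → H →L[ℂ] H) (S : ℕ → H → H) : Prop where
  norm_map : ∀ n x, ‖S n x‖ = ‖x‖
  inner_map : ∀ n j x y, inner ℂ (S n x) (A j (S n y)) = inner ℂ x (A j y)
  tendsto : ∀ x y, Tendsto (fun n => inner ℂ x (S n y)) atTop (𝓝 0)

variable {A : Fin d → H →L[ℂ] H} {S : ℕ → H → H}

/-- A compression does not increase norms: test `A j (S n y)` against `S n (A j y)` and apply
Cauchy–Schwarz. -/
theorem IsWeaklyNullDilation.norm_apply_le (hS : IsWeaklyNullDilation A S) (n : ℕ) (j : Fin d)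
    (y : H) : ‖A j y‖ ≤ ‖A j (S n y)‖ := by
  rcases (norm_nonneg (A j y)).eq_or_lt with h | h
  · rw [← h]; exact norm_nonneg _
  have h1 : ‖A j y‖ * ‖A j y‖ ≤ ‖A j y‖ * ‖A j (S n y)‖ := by
    calc ‖A j y‖ * ‖A j y‖ = ‖inner ℂ (S n (A j y)) (A j (S n y))‖ := by
          rw [hS.inner_map, inner_self_eq_norm_sq_to_K]; simp [sq]
      _ ≤ ‖S n (A j y)‖ * ‖A j (S n y)‖ := norm_inner_le_norm _ _
      _ = _ := by rw [hS.norm_map]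
  exact le_of_mul_le_mul_left h1 h

/-- The set of pairs `(⟨x, A x⟩, ‖A x‖²)` is, asymptotically, convex. -/
theorem IsWeaklyNullDilation.sum_convex_combination_le [CompleteSpace H]
    (hS : IsWeaklyNullDilation A S) {V : ℝ} (hV : ∀ x : H, ‖x‖ = 1 → tupleVar A x ≤ V)
    {x y : H} (hx : ‖x‖ = 1) (hy : ‖y‖ = 1) {a b : ℝ} (hab : a ^ 2 + b ^ 2 = 1) :
    ∑ j, (a ^ 2 * ‖A j x‖ ^ 2 + b ^ 2 * ‖A j y‖ ^ 2 -
      ‖(a : ℂ) ^ 2 * inner ℂ x (A j x) + (b : ℂ) ^ 2 * inner ℂ y (A j y)‖ ^ 2) ≤ V := by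
  let u : ℕ → H := fun n => (a : ℂ) • x + (b : ℂ) • S n y
  have hweak : ∀ j w, Tendsto (fun n => inner ℂ w (A j (S n y))) atTop (𝓝 0) := fun j w => by
    simpa only [ContinuousLinearMap.adjoint_inner_left] using
      hS.tendsto (ContinuousLinearMap.adjoint (A j) w) y
  have hweak' : ∀ w, Tendsto (fun n => inner ℂ (S n y) w) atTop (𝓝 0) := fun w => by
    have := (RCLike.continuous_conj (K := ℂ)).continuousAt.tendsto.comp (hS.tendsto w y)
    simpa [Function.comp_def, inner_conj_symm] using this
  have hu : Tendsto (fun n => ‖u n‖ ^ 2) atTop (𝓝 1) := by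
    have h1 : ∀ n, ‖u n‖ ^ 2 = 1 + 2 * (a * b * inner ℂ x (S n y) : ℂ).re := fun n => by
      simp only [u]
      rw [@norm_add_sq ℂ, inner_smul_left, inner_smul_right, norm_smul, norm_smul, hS.norm_map,
        hx, hy]
      simp only [Complex.conj_ofReal, Complex.norm_real, Real.norm_eq_abs, mul_one, sq_abs,
        RCLike.re_to_complex, mul_assoc]
      linear_combination hab
    have h2 := (Complex.continuous_re.tendsto 0).comp
      (by simpa using (hS.tendsto x y).const_mul ((a : ℂ) * b))
    simp_rw [h1]
    simpa [Function.comp_def] using (h2.const_mul 2).const_add 1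
  have hi : ∀ j, Tendsto (fun n => inner ℂ (u n) (A j (u n))) atTop
      (𝓝 ((a : ℂ) ^ 2 * inner ℂ x (A j x) + (b : ℂ) ^ 2 * inner ℂ y (A j y))) := fun j => by
    have h1 : ∀ n, inner ℂ (u n) (A j (u n)) =
        (a : ℂ) ^ 2 * inner ℂ x (A j x) + (b : ℂ) ^ 2 * inner ℂ y (A j y) +
          (a * b * inner ℂ x (A j (S n y)) + a * b * inner ℂ (S n y) (A j x)) := fun n => by
      simp only [u, map_add, map_smul, inner_add_left, inner_add_right, inner_smul_left,
        inner_smul_right, hS.inner_map, Complex.conj_ofReal]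
      ring
    simp_rw [h1]
    simpa using (((hweak j x).const_mul ((a : ℂ) * b)).add
      ((hweak' (A j x)).const_mul ((a : ℂ) * b))).const_add _
  -- `N j n` is `‖A j (u n)‖²` with `‖A j (S n y)‖` lowered to `‖A j y‖`; the hypotheses do not make
  -- the former converge.
  let N : Fin d → ℕ → ℝ := fun j n => a ^ 2 * ‖A j x‖ ^ 2 + b ^ 2 * ‖A j y‖ ^ 2 +
    2 * (a * b * inner ℂ (A j x) (A j (S n y)) : ℂ).re
  have hN : ∀ j, Tendsto (N j) atTop (𝓝 (a ^ 2 * ‖A j x‖ ^ 2 + b ^ 2 * ‖A j y‖ ^ 2)) := fun j => by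
    have h2 := (Complex.continuous_re.tendsto 0).comp
      (by simpa using (hweak j (A j x)).const_mul ((a : ℂ) * b))
    simpa [Function.comp_def, N] using (h2.const_mul 2).const_add _
  have hNle : ∀ j n, N j n ≤ ‖A j (u n)‖ ^ 2 := fun j n => by
    have h1 : ‖A j (u n)‖ ^ 2 = a ^ 2 * ‖A j x‖ ^ 2 + b ^ 2 * ‖A j (S n y)‖ ^ 2 +
        2 * (a * b * inner ℂ (A j x) (A j (S n y)) : ℂ).re := by
      simp only [u, map_add, map_smul]
      rw [@norm_add_sq ℂ, inner_smul_left, inner_smul_right, norm_smul, norm_smul]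
      simp only [Complex.conj_ofReal, Complex.norm_real, Real.norm_eq_abs, mul_pow, sq_abs,
        RCLike.re_to_complex, mul_assoc]
      ring
    rw [h1]
    have := hS.norm_apply_le n j y
    simp only [N]
    gcongr
  have hlim : Tendsto (fun n => ∑ j, (N j n * ‖u n‖ ^ 2 - ‖inner ℂ (u n) (A j (u n))‖ ^ 2)) atTop
      (𝓝 (∑ j, ((a ^ 2 * ‖A j x‖ ^ 2 + b ^ 2 * ‖A j y‖ ^ 2) * 1 -
        ‖(a : ℂ) ^ 2 * inner ℂ x (A j x) + (b : ℂ) ^ 2 * inner ℂ y (A j y)‖ ^ 2))) :=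
    tendsto_finsetSum _ fun j _ => ((hN j).mul hu).sub ((hi j).norm.pow 2)
  have hlim' : Tendsto (fun n => V * (‖u n‖ ^ 2) ^ 2) atTop (𝓝 (V * 1 ^ 2)) :=
    (hu.pow 2).const_mul V
  have := le_of_tendsto_of_tendsto' hlim hlim' fun n =>
    (Finset.sum_le_sum fun j _ => sub_le_sub_right
      (mul_le_mul_of_nonneg_right (hNle j n) (sq_nonneg _)) _).trans
      (norm_sq_mul_sub_le_of_tupleVar_le hV (u n))
  simpa using this

/-- This is the previous estimate with `a² = 1 - t`, `b² = t`, expanded around the means at `x` to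
isolate the term of order `t²`. -/
theorem IsWeaklyNullDilation.tupleVar_add_le [CompleteSpace H]
    (hS : IsWeaklyNullDilation A S) {V : ℝ} (hV : ∀ x : H, ‖x‖ = 1 → tupleVar A x ≤ V)
    {x y : H} (hx : ‖x‖ = 1) (hy : ‖y‖ = 1) {t : ℝ} (ht0 : 0 ≤ t) (ht1 : t ≤ 1) :
    (1 - t) * tupleVar A x +
        t * ‖tupleOp (A - scalarTuple H fun j => inner ℂ x (A j x)) y‖ ^ 2 -
        t ^ 2 * ∑ j, ‖inner ℂ x (A j x) - inner ℂ y (A j y)‖ ^ 2 ≤ V := by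
  have ha : √(1 - t) ^ 2 = 1 - t := Real.sq_sqrt (by linarith)
  have hb : √t ^ 2 = t := Real.sq_sqrt ht0
  refine le_of_eq_of_le ?_
    (hS.sum_convex_combination_le hV hx hy (a := √(1 - t)) (b := √t) (by rw [ha, hb]; ring))
  rw [norm_tupleOp_sub_scalarTuple_apply_sq _ _ hy, tupleVar_eq_sum, Finset.mul_sum,
    Finset.mul_sum, Finset.mul_sum, ← Finset.sum_add_distrib, ← Finset.sum_sub_distrib]
  refine Finset.sum_congr rfl fun j _ => ?_
  rw [← Complex.ofReal_pow, ← Complex.ofReal_pow, ha, hb]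
  simp only [← Complex.normSq_eq_norm_sq, Complex.normSq_apply, Complex.sub_re, Complex.sub_im,
    Complex.mul_re, Complex.mul_im, Complex.add_re, Complex.add_im, Complex.conj_re,
    Complex.conj_im, Complex.ofReal_re, Complex.ofReal_im]
  ring

/-- The variance formula for the distance to the scalar tuples, for tuples that admit a weakly
null sequence of dilating isometries. -/
theorem IsWeaklyNullDilation.distScalars_eq [CompleteSpace H] [Nontrivial H]
    (hS : IsWeaklyNullDilation A S) :
    (∃ z : Fin d → ℂ, distScalars A = ‖tupleOp (A - scalarTuple H z)‖) ∧
      IsLUB {v : ℝ | ∃ x : H, ‖x‖ = 1 ∧ v = tupleVar A x} (distScalars A ^ 2) := by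
  set W : Set ℝ := {v : ℝ | ∃ x : H, ‖x‖ = 1 ∧ v = tupleVar A x} with hW
  have hub : distScalars A ^ 2 ∈ upperBounds W := by
    rintro _ ⟨x, hx, rfl⟩
    exact tupleVar_le_distScalars_sq A hx
  obtain ⟨x₀, hx₀⟩ := exists_norm_eq H zero_le_one
  have hne : W.Nonempty := ⟨_, x₀, hx₀, rfl⟩
  have hlub : IsLUB W (sSup W) := isLUB_csSup hne ⟨_, hub⟩
  have hV : ∀ x : H, ‖x‖ = 1 → tupleVar A x ≤ sSup W := fun x hx => hlub.1 ⟨x, hx, rfl⟩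
  obtain ⟨v, -, hv, hvW⟩ := exists_seq_tendsto_sSup hne ⟨_, hub⟩
  choose x hx hvx using hvW
  let c : ℕ → Fin d → ℂ := fun n j => inner ℂ (x n) (A j (x n))
  have hc : ∀ n, c n ∈ Metric.closedBall (0 : Fin d → ℂ) (∑ j, ‖A j‖) := fun n => by
    rw [mem_closedBall_zero_iff, pi_norm_le_iff_of_nonneg (by positivity)]
    intro j
    calc ‖inner ℂ (x n) (A j (x n))‖ ≤ ‖x n‖ * ‖A j (x n)‖ := norm_inner_le_norm _ _
      _ ≤ ‖A j‖ := by simpa [hx n] using (A j).le_opNorm (x n)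
      _ ≤ _ := Finset.single_le_sum (f := fun j => ‖A j‖) (fun _ _ => norm_nonneg _)
        (Finset.mem_univ j)
  -- The limit `m` of the means along a maximizing sequence will be the minimizer.
  obtain ⟨m, -, k, hk, hm⟩ := tendsto_subseq_of_bounded Metric.isBounded_closedBall hc
  have hmj : ∀ j, Tendsto (fun n => c (k n) j) atTop (𝓝 (m j)) := tendsto_pi_nhds.1 hm
  have hbound : ∀ y : H, ‖y‖ = 1 → ‖tupleOp (A - scalarTuple H m) y‖ ^ 2 ≤ sSup W := by
    intro y hy
    have hQ : Tendsto (fun n => ‖tupleOp (A - scalarTuple H (c (k n))) y‖ ^ 2) atTop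
        (𝓝 (‖tupleOp (A - scalarTuple H m) y‖ ^ 2)) := by
      simp_rw [norm_tupleOp_apply_sq]
      refine tendsto_finsetSum _ fun j _ => ((tendsto_const_nhds.sub
        ((hmj j).smul_const y)).norm.pow 2)
    have hR : Tendsto (fun n => ∑ j, ‖c (k n) j - inner ℂ y (A j y)‖ ^ 2) atTop
        (𝓝 (∑ j, ‖m j - inner ℂ y (A j y)‖ ^ 2)) :=
      tendsto_finsetSum _ fun j _ => ((hmj j).sub_const _).norm.pow 2
    have hv' : Tendsto (fun n => tupleVar A (x (k n))) atTop (𝓝 (sSup W)) := by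
      simpa only [Function.comp_def, hvx] using hv.comp hk.tendsto_atTop
    -- In the limit `(1 - t) V + t Q - t² R ≤ V`; the terms `V` cancel and a factor `t` divides out.
    have hineq : ∀ t : ℝ, 0 < t → t ≤ 1 → ‖tupleOp (A - scalarTuple H m) y‖ ^ 2 ≤
        sSup W + t * ∑ j, ‖m j - inner ℂ y (A j y)‖ ^ 2 := by
      intro t ht0 ht1
      have h1 := le_of_tendsto' (((hv'.const_mul (1 - t)).add (hQ.const_mul t)).sub
        (hR.const_mul (t ^ 2))) fun n => hS.tupleVar_add_le hV (hx (k n)) hy ht0.le ht1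
      refine le_of_mul_le_mul_left ?_ ht0
      linarith
    have hlim : Tendsto (fun t : ℝ => sSup W + t * ∑ j, ‖m j - inner ℂ y (A j y)‖ ^ 2)
        (𝓝[>] 0) (𝓝 (sSup W)) := by
      have : Continuous fun t : ℝ => sSup W + t * ∑ j, ‖m j - inner ℂ y (A j y)‖ ^ 2 := by fun_prop
      simpa using (this.tendsto 0).mono_left nhdsWithin_le_nhds
    refine ge_of_tendsto hlim ?_
    filter_upwards [Ioc_mem_nhdsGT (zero_lt_one (α := ℝ))] with t ht using hineq t ht.1 ht.2
  have hV0 : 0 ≤ sSup W := (sq_nonneg _).trans (hbound x₀ hx₀)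
  have hnorm : ‖tupleOp (A - scalarTuple H m)‖ ≤ √(sSup W) := by
    refine ContinuousLinearMap.opNorm_le_of_unit_norm (𝕜 := ℂ) (Real.sqrt_nonneg _) fun y hy => ?_
    exact Real.le_sqrt_of_sq_le (hbound y hy)
  have hnorm_sq : ‖tupleOp (A - scalarTuple H m)‖ ^ 2 ≤ sSup W :=
    (Real.le_sqrt (ContinuousLinearMap.opNorm_nonneg _) hV0).1 hnorm
  have h0 : 0 ≤ distScalars A := Real.iInf_nonneg fun _ => ContinuousLinearMap.opNorm_nonneg _
  have hle := hlub.2 hub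
  refine ⟨⟨m, (distScalars_le A m).antisymm ?_⟩, ?_⟩
  · exact (abs_le_of_sq_le_sq' (hnorm_sq.trans hle) h0).2
  · have : distScalars A ^ 2 = sSup W :=
      le_antisymm ((pow_le_pow_left₀ h0 (distScalars_le A m) 2).trans hnorm_sq) hle
    rwa [this]

end Tuples

/-! ### The shift on the Hardy space and Toeplitz operators. -/

section Toeplitz

open Filter Topology

theorem coeFn_mulOp (φ : CircleLinfty) (f : CircleL2) :
    mulOp φ f =ᵐ[circleMeasure] fun t => φ t * f t :=
  ContinuousLinearMap.coeFn_holder _ φ f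

theorem mulOp_comm (φ ψ : CircleLinfty) (f : CircleL2) :
    mulOp φ (mulOp ψ f) = mulOp ψ (mulOp φ f) := by
  refine Lp.ext ?_
  filter_upwards [coeFn_mulOp φ (mulOp ψ f), coeFn_mulOp ψ (mulOp φ f), coeFn_mulOp φ f,
    coeFn_mulOp ψ f] with t h1 h2 h3 h4
  rw [h1, h2, h3, h4]
  ring

theorem mulOp_fourierLp (m n : ℤ) :
    mulOp (fourierLp ∞ m) (fourierLp 2 n) = fourierLp 2 (m + n) := by
  refine Lp.ext ?_
  filter_upwards [coeFn_mulOp (fourierLp ∞ m) (fourierLp 2 n),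
    coeFn_fourierLp (T := 1) ∞ m, coeFn_fourierLp (T := 1) 2 n,
    coeFn_fourierLp (T := 1) 2 (m + n)] with t h1 h2 h3 h4
  rw [h1, h2, h3, h4, fourier_add]

theorem inner_mulOp_fourierLp (n : ℤ) (f g : CircleL2) :
    inner ℂ (mulOp (fourierLp ∞ n) f) (mulOp (fourierLp ∞ n) g) = inner ℂ f g := by
  rw [L2.inner_def, L2.inner_def]
  refine integral_congr_ae ?_
  filter_upwards [coeFn_mulOp (fourierLp ∞ n) f, coeFn_mulOp (fourierLp ∞ n) g,
    coeFn_fourierLp (T := 1) ∞ n] with t h1 h2 h3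
  have h : starRingEnd ℂ (fourier n t) * fourier n t = 1 := by
    rw [← fourier_neg, ← fourier_add, neg_add_cancel, fourier_zero]
  rw [h1, h2, h3]
  simp only [RCLike.inner_apply, map_mul]
  linear_combination (g t * starRingEnd ℂ (f t)) * h

theorem norm_mulOp_fourierLp (n : ℤ) (f : CircleL2) : ‖mulOp (fourierLp ∞ n) f‖ = ‖f‖ := by
  rw [@norm_eq_sqrt_re_inner ℂ, inner_mulOp_fourierLp, ← @norm_eq_sqrt_re_inner ℂ]

theorem fourierCoeff_eq_inner (f : CircleL2) (k : ℤ) :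
    fourierCoeff f k = inner ℂ (fourierLp 2 k) f := by
  rw [← fourierBasis_repr, HilbertBasis.repr_apply_apply, coe_fourierBasis]

theorem inner_fourierLp_mulOp (n k : ℤ) (f : CircleL2) :
    inner ℂ (fourierLp 2 k) (mulOp (fourierLp ∞ n) f) = inner ℂ (fourierLp 2 (k - n)) f := by
  rw [← inner_mulOp_fourierLp n (fourierLp 2 (k - n)), mulOp_fourierLp, add_sub_cancel]

theorem mem_hardySpace_iff (f : CircleL2) :
    f ∈ hardySpace ↔ ∀ n : ℤ, n < 0 → inner ℂ (fourierLp 2 n) f = 0 := by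
  simp_rw [← fourierCoeff_eq_inner]
  rfl

theorem fourierLp_mem_hardySpace {n : ℤ} (hn : 0 ≤ n) : fourierLp 2 n ∈ hardySpace := by
  rw [mem_hardySpace_iff]
  exact fun k hk => orthonormal_fourier.2 (by lia)

theorem mulOp_fourierLp_mem_hardySpace (n : ℕ) {f : CircleL2} (hf : f ∈ hardySpace) :
    mulOp (fourierLp ∞ n) f ∈ hardySpace := by
  rw [mem_hardySpace_iff] at hf ⊢
  intro k hk
  rw [inner_fourierLp_mulOp]
  exact hf _ (by lia)

/-- By Bessel's inequality the coefficients are square-summable. -/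
theorem tendsto_inner_fourierLp_sub (k : ℤ) (f : CircleL2) :
    Tendsto (fun n : ℕ => inner ℂ (fourierLp 2 (k - n)) f) atTop (𝓝 0) := by
  have h1 : Tendsto (fun i : ℤ => ‖inner ℂ (fourierLp 2 i : CircleL2) f‖ ^ 2) cofinite (𝓝 0) :=
    (orthonormal_fourier.inner_products_summable (x := f)).tendsto_cofinite_zero
  have h2 : Tendsto (fun n : ℕ => k - (n : ℤ)) atTop cofinite := by
    rw [← Nat.cofinite_eq_atTop]
    exact Function.Injective.tendsto_cofinite fun a b h => by simpa using h
  rw [tendsto_zero_iff_norm_tendsto_zero]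
  simpa [Function.comp_def] using (h1.comp h2).sqrt

/-- Multiplication by high powers of the coordinate function tends weakly to zero on `L²`. -/
theorem tendsto_inner_mulOp_fourierLp (f g : CircleL2) :
    Tendsto (fun n : ℕ => inner ℂ f (mulOp (fourierLp ∞ n) g)) atTop (𝓝 0) := by
  have hcl : f ∈ (Submodule.span ℂ (Set.range (fourierLp (T := 1) 2))).topologicalClosure := by
    rw [span_fourierLp_closure_eq_top (by simp)]
    trivial
  -- Since the multiplications are isometric, the error from approximating `f` is uniform in `n`, so
  -- trigonometric polynomials suffice.
  have hspan : ∀ h ∈ Submodule.span ℂ (Set.range (fourierLp (T := 1) 2)),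
      Tendsto (fun n : ℕ => inner ℂ h (mulOp (fourierLp ∞ n) g)) atTop (𝓝 0) := by
    intro h hh
    induction hh using Submodule.span_induction with
    | mem x hx =>
      obtain ⟨k, rfl⟩ := hx
      simpa only [inner_fourierLp_mulOp] using tendsto_inner_fourierLp_sub k g
    | zero => simp
    | add x y _ _ hx hy => simpa [inner_add_left] using hx.add hy
    | smul a x _ hx => simpa [inner_smul_left] using hx.const_mul _
  rw [Metric.tendsto_atTop]
  intro ε hε
  -- The `+ 1` covers `g = 0`.
  have hδ : 0 < ε / 2 / (‖g‖ + 1) := by positivity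
  obtain ⟨h, hh, hfh⟩ := Metric.mem_closure_iff.1 hcl _ hδ
  obtain ⟨N, hN⟩ := Metric.tendsto_atTop.1 (hspan h hh) (ε / 2) (half_pos hε)
  refine ⟨N, fun n hn => ?_⟩
  have h1 := hN n hn
  rw [dist_zero_right] at h1 ⊢
  rw [dist_eq_norm, lt_div_iff₀ (by positivity)] at hfh
  have h2 : ‖inner ℂ (f - h) (mulOp (fourierLp ∞ n) g)‖ ≤ ‖f - h‖ * ‖g‖ := by
    simpa only [norm_mulOp_fourierLp] using norm_inner_le_norm (𝕜 := ℂ) (f - h)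
      (mulOp (fourierLp ∞ n) g)
  rw [← sub_add_cancel f h, inner_add_left]
  refine (norm_add_le _ _).trans_lt ?_
  nlinarith [norm_nonneg (f - h)]

/-- The `n`-th power of the unilateral shift on the Hardy space. -/
noncomputable def hardyShift (n : ℕ) (f : hardySpace) : hardySpace :=
  ⟨mulOp (fourierLp ∞ n) f, mulOp_fourierLp_mem_hardySpace n f.2⟩

theorem inner_toeplitz (φ : CircleLinfty) (f g : hardySpace) :
    inner ℂ f (toeplitz φ g) = inner ℂ (f : CircleL2) (mulOp φ g) :=
  hardySpace.inner_orthogonalProjectionOnto_eq_of_mem_left f (mulOp φ g)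

/-- Paired with a vector of `H²`, the projection disappears; multiplication by `φ` commutes with the
unitary multiplication by `zⁿ`. -/
theorem isWeaklyNullDilation_hardyShift {d : ℕ} {A : Fin d → hardySpace →L[ℂ] hardySpace}
    (hA : ∀ j, IsToeplitz (A j)) : IsWeaklyNullDilation A hardyShift where
  norm_map n f := norm_mulOp_fourierLp n f
  inner_map n j f g := by
    obtain ⟨φ, hφ⟩ := hA j
    rw [hφ, inner_toeplitz, inner_toeplitz, hardyShift, hardyShift, mulOp_comm,
      inner_mulOp_fourierLp]
  tendsto f g := tendsto_inner_mulOp_fourierLp f g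

instance : Nontrivial hardySpace :=
  ⟨⟨fourierLp 2 0, fourierLp_mem_hardySpace le_rfl⟩, 0, fun h => by
    have h1 := congrArg (fun f : hardySpace => ‖(f : CircleL2)‖) h
    have h2 := orthonormal_fourier (T := 1).1 0
    simp [h2] at h1⟩

theorem toeplitz_fourierLp_apply (m : ℤ) {n : ℤ} (hn : 0 ≤ n) (hmn : 0 ≤ m + n) :
    toeplitz (fourierLp ∞ m) ⟨fourierLp 2 n, fourierLp_mem_hardySpace hn⟩ =
      ⟨fourierLp 2 (m + n), fourierLp_mem_hardySpace hmn⟩ := by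
  have h : toeplitz (fourierLp ∞ m) ⟨fourierLp 2 n, fourierLp_mem_hardySpace hn⟩ =
    hardySpace.orthogonalProjectionOnto (mulOp (fourierLp ∞ m) (fourierLp 2 n)) := rfl
  rw [h, mulOp_fourierLp]
  exact hardySpace.orthogonalProjectionOnto_mem_subspace_eq_self
    ⟨fourierLp 2 (m + n), fourierLp_mem_hardySpace hmn⟩

theorem toeplitz_fourierLp_apply_eq_zero (m : ℤ) {n : ℤ} (hn : 0 ≤ n) (hmn : m + n < 0) :
    toeplitz (fourierLp ∞ m) ⟨fourierLp 2 n, fourierLp_mem_hardySpace hn⟩ = 0 := by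
  have h : toeplitz (fourierLp ∞ m) ⟨fourierLp 2 n, fourierLp_mem_hardySpace hn⟩ =
    hardySpace.orthogonalProjectionOnto (mulOp (fourierLp ∞ m) (fourierLp 2 n)) := rfl
  rw [h, mulOp_fourierLp]
  refine hardySpace.orthogonalProjectionOnto_apply_of_mem_orthogonal ?_
  rw [Submodule.mem_orthogonal']
  exact fun f hf => (mem_hardySpace_iff f).1 hf _ hmn

/-- The unilateral shift and its adjoint do not commute. -/
theorem toeplitz_fourierLp_mul_ne :
    toeplitz (fourierLp ∞ 1) * toeplitz (fourierLp ∞ (-1)) ≠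
      toeplitz (fourierLp ∞ (-1)) * toeplitz (fourierLp ∞ 1) := by
  intro h
  -- On the constant function `1`, the backward shift gives `0`, whereas shifting forward and then
  -- back returns `1`.
  have h1 := DFunLike.congr_fun h ⟨fourierLp 2 0, fourierLp_mem_hardySpace le_rfl⟩
  rw [mul_apply_eq_comp, mul_apply_eq_comp,
    toeplitz_fourierLp_apply_eq_zero (-1) le_rfl (by norm_num), map_zero,
    toeplitz_fourierLp_apply 1 le_rfl (by norm_num),
    toeplitz_fourierLp_apply (-1) (by norm_num) (by norm_num)] at h1
  have h2 := congrArg (fun f : hardySpace => ‖(f : CircleL2)‖) h1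
  have h3 := orthonormal_fourier (T := 1).1 (-1 + (1 + 0))
  simp only [h3] at h2
  simp at h2

end Toeplitz

theorem corollary10 :
    (∀ (d : ℕ) (A : Fin d → hardySpace →L[ℂ] hardySpace), (∀ j, IsToeplitz (A j)) →
      (∃ z : Fin d → ℂ, distScalars A = ‖tupleOp (A - scalarTuple hardySpace z)‖) ∧
      IsLUB {v : ℝ | ∃ x : hardySpace, ‖x‖ = 1 ∧ v = tupleVar A x} (distScalars A ^ 2)) ∧
    (∀ d : ℕ, 2 ≤ d → ∃ A : Fin d → hardySpace →L[ℂ] hardySpace,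
      (∀ j, IsToeplitz (A j)) ∧ ∃ i j, A i * A j ≠ A j * A i) := by
  refine ⟨fun d A hA => (isWeaklyNullDilation_hardyShift hA).distScalars_eq, fun d hd => ?_⟩
  -- Entry `0` is the shift and all others are the backward shift.
  refine ⟨fun j => toeplitz (fourierLp ∞ (if (j : ℕ) = 0 then 1 else -1)), fun j => ⟨_, rfl⟩,
    ⟨0, by lia⟩, ⟨1, by lia⟩, ?_⟩
  simpa using toeplitz_fourierLp_mul_ne
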